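/- **Theorem 2.1.** Let $\mathbb{F}$ be $\mathbb{R}$ or $\mathbb{C}$ and let $N\ge 0$ be an integer. For $1\le d\le N$ consider the differential operator $$D_d:=d!\sum_{I\subseteq\{1,\dots,N\},\ |I|=d}\ \sum_{i\in I}\frac{\partial_i}{\prod_{j\in I,\ j\ne i}(x_j-x_i)},\qquad \partial_i=\frac{\partial}{\partial x_i},$$ acting at points $x\in\mathbb{F}^N$ with pairwise distinct coordinates. For $0\le h\le N$ put $\tilde e_h:=\frac{(N-h)!}{N!}e_h$, where $e_h$ is the $h$th elementary symmetric polynomial in $x_1,\dots,x_N$, and for $1\le r\le N$ put $$u_r:=\sum_{\lambda\vdash r}(-1)^{l(\lambda)-1}\frac{(l(\lambda)-1)!}{\prod_{h=1}^{r}m_h!}\prod_{h=1}^{r}\tilde e_h^{\,m_h},$$ where $m_h$ is the multiplicity of $h$ in the partition $\lambda$ and $l(\lambda)=\sum_h m_h$. For every $1\le r\le N$ let $v_r\in\mathbb{F}[x_1,\dots,x_N]$ be a symmetric polynomial that is homogeneous of degree $r$, and assume that $v_1,\dots,v_N$ are algebraically independent over $\mathbb{F}$ (i.e. they are coordinates for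 symmetric functions). When a continuously differentiable (holomorphic if $\mathbb{F}=\mathbb{C}$) symmetric function $\phi:\mathbb{F}^N\to\mathbb{F}$ is written as $\phi(x_1,\dots,x_N)=\eta(v_1,\dots,v_N)$, denote by $\eta_{v_r}$ the derivative of $\eta$ with respect to its $r$th variable, evaluated at $(v_1(x),\dots,v_N(x))$ at any point $x$ with distinct coordinates such that $\eta$ is differentiable there. Suppose that for every $1\le r\le N$: 1. (no non-constant numerators) there are finitely many constants $c_k\in\mathbb{F}$, indices $i_k\in\{1,\dots,N\}$ and nonzero polynomials $p_k\in\mathbb{F}[x_1,\dots,x_N]$, not depending on $\phi$, such that for all such $\phi$ and $\eta$ $$\eta_{v_r}=\sum_k c_k\,\frac{\partial_{i_k}\phi(x)}{p_k(x)}$$ at every such point $x$ at which no $p_k$ vanishes; 2. (the terms of $D_r\phi$ appear with coefficient $1$) in the expansion $\eta_{v_r}=\sum_{d=1}^{N}q_{d,r}(x)\,D_d\phi(x)$, whose coefficients $q_{d,r}$ are functions of $x$ that do not depend on $\phi$, the coefficient $q_{r,r}$ is identically $1$ on the points with distinct coordinates. Then $v_r=u_r$ for every $1\le r\le N$. -/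

import Mathlib

namespace SymCoord

open Finset

/-- The partial derivative `∂f/∂x_i` at `x` of a function of the variables `(x_i)_{i ∈ ι}`. -/
noncomputable def partialAt {𝕜 ι : Type*} [RCLike 𝕜] [Fintype ι] [DecidableEq ι]
    (f : (ι → 𝕜) → 𝕜) (i : ι) (x : ι → 𝕜) : 𝕜 :=
  fderiv 𝕜 f x (Pi.single i 1)

/-- The operator `D_I = ∑_{i ∈ I} ∂_i / ∏_{j ∈ I, j ≠ i} (x_j - x_i)`, at the point `x`
(meaningful when the coordinates of `x` are distinct). -/
noncomputable def DSet {𝕜 : Type*} [RCLike 𝕜] {N : ℕ} (I : Finset (Fin N))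
    (φ : (Fin N → 𝕜) → 𝕜) (x : Fin N → 𝕜) : 𝕜 :=
  ∑ i ∈ I, partialAt φ i x / ∏ j ∈ I.erase i, (x j - x i)

/-- The operator `D_d = d! ∑_{|I| = d} D_I`, at the point `x`. -/
noncomputable def D {𝕜 : Type*} [RCLike 𝕜] {N : ℕ} (d : ℕ)
    (φ : (Fin N → 𝕜) → 𝕜) (x : Fin N → 𝕜) : 𝕜 :=
  (d.factorial : 𝕜) * ∑ I ∈ powersetCard d (univ : Finset (Fin N)), DSet I φ x

/-- The normalized elementary symmetric polynomial `(N - h)! / N! • e_h` in `N` variables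
(used only for `h ≤ N`). -/
noncomputable def eNorm (𝕜 : Type*) [RCLike 𝕜] (N h : ℕ) : MvPolynomial (Fin N) 𝕜 :=
  MvPolynomial.C (((N - h).factorial : 𝕜) / (N.factorial : 𝕜)) *
    MvPolynomial.esymm (Fin N) 𝕜 h

/-- The coordinate
`u_r = ∑_{λ ⊢ r} (-1)^{l(λ) - 1} (l(λ) - 1)! / ∏_h m_h! • ∏_h (eNorm h)^{m_h}`,
where `m_h` is the multiplicity of `h` in `λ` and `l(λ)` is the number of parts
(used only for `1 ≤ r ≤ N`). -/
noncomputable def u (𝕜 : Type*) [RCLike 𝕜] (N r : ℕ) : MvPolynomial (Fin N) 𝕜 :=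
  ∑ p : Nat.Partition r,
    MvPolynomial.C
      ((-1 : 𝕜) ^ (p.parts.card - 1) * ((p.parts.card - 1).factorial : 𝕜) /
        ∏ h ∈ Icc 1 r, ((p.parts.count h).factorial : 𝕜)) *
      (p.parts.map (eNorm 𝕜 N)).prod

/-- The point `(v_1(x), …, v_N(x))`. -/
noncomputable def evalAll {𝕜 : Type*} [RCLike 𝕜] {N : ℕ}
    (v : Fin N → MvPolynomial (Fin N) 𝕜) (x : Fin N → 𝕜) : Fin N → 𝕜 :=
  fun r => MvPolynomial.eval x (v r)

/-- `φ` is a continuously differentiable (holomorphic if `𝕜 = ℂ`) symmetric function, and `η` is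
a way of writing it in terms of `v`: `φ(x_1, …, x_N) = η(v_1, …, v_N)`. -/
structure Represents {𝕜 : Type*} [RCLike 𝕜] {N : ℕ}
    (v : Fin N → MvPolynomial (Fin N) 𝕜) (φ η : (Fin N → 𝕜) → 𝕜) : Prop where
  contDiff : ContDiff 𝕜 1 φ
  symm : ∀ (σ : Equiv.Perm (Fin N)) (x : Fin N → 𝕜), φ (fun i => x (σ i)) = φ x
  eq_comp : ∀ x : Fin N → 𝕜, φ x = η (evalAll v x)

/-- `∂η/∂v_r` is an expression in the `x`-derivatives of `φ` and denominators only: it is a finite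
sum of terms `c • φ_i / p` with constants `c` and nonzero polynomials `p` that do not depend on
`φ`. The equality is required only where the `x_i` are distinct and no denominator vanishes. -/
def NoNumerators {𝕜 : Type*} [RCLike 𝕜] {N : ℕ}
    (v : Fin N → MvPolynomial (Fin N) 𝕜) (r : Fin N) : Prop :=
  ∃ (m : ℕ) (c : Fin m → 𝕜) (i : Fin m → Fin N) (p : Fin m → MvPolynomial (Fin N) 𝕜),
    (∀ k, p k ≠ 0) ∧
    ∀ φ η : (Fin N → 𝕜) → 𝕜, Represents v φ η →
      ∀ x : Fin N → 𝕜, Function.Injective x → (∀ k, MvPolynomial.eval x (p k) ≠ 0) →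
        DifferentiableAt 𝕜 η (evalAll v x) →
        partialAt η r (evalAll v x) =
          ∑ k, c k * (partialAt φ (i k) x / MvPolynomial.eval x (p k))

/-- `D_r φ` appears in `∂η/∂v_r` with coefficient `1`: in the expansion (unique at points with
distinct `x_i`) of `∂η/∂v_r` as a combination of `D_1 φ, …, D_N φ`, whose coefficients are
functions of `x` that do not depend on `φ`, the coefficient of `D_r φ` is `1`. The index `d : Fin N`
stands for the integer `d + 1`. -/
def LeadingCoeffOne {𝕜 : Type*} [RCLike 𝕜] {N : ℕ}
    (v : Fin N → MvPolynomial (Fin N) 𝕜) (r : Fin N) : Prop :=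
  ∃ q : Fin N → (Fin N → 𝕜) → 𝕜,
    (∀ x : Fin N → 𝕜, Function.Injective x → q r x = 1) ∧
    ∀ φ η : (Fin N → 𝕜) → 𝕜, Represents v φ η →
      ∀ x : Fin N → 𝕜, Function.Injective x →
        DifferentiableAt 𝕜 η (evalAll v x) →
        partialAt η r (evalAll v x) = ∑ d : Fin N, q d x * D ((d : ℕ) + 1) φ x

end SymCoord

/-! Testing both hypotheses on `φ = v_k`, `η` the `k`th coordinate function, makes the coefficients
`Q` of the `D_d` the inverse of the matrix `T = (D_d v_k)`. The goal is `T = 1`. The `u_k` satisfy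
the same equations, and the `D_d` determine the gradient at points with distinct coordinates, so
`v_k - u_k` is then constant; it vanishes at `0`.

For the `u_k` (`pointD_u`): Lagrange interpolation shows that the weights of `D_d` turn the products
of `X + x_j` over `j ≠ i` into the `d`th derivative of the full product. Hence `D_d` sends `eNorm k`
to `eNorm (k - d)`, or to `0` if `k < d` (`pointD_eNorm`). So the derivation `D_d` multiplies the
generating series of the `eNorm h` by `t ^ d` up to order `N`, and its logarithm, whose coefficients
are the `u_r`, has `D_d`-derivative `t ^ d` in these orders.

For the `v_k`: `T` has symmetric polynomial entries and is upper triangular with constant diagonal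
by homogeneity, so `Q` has symmetric polynomial entries too (`exists_symmetric_inverse`). Without
numerators, the coefficients of the `∂_i` in `∂η/∂v_r` are bounded at infinity along suitable lines.
Along the diagonal direction the weights are constant, which forces the entries of `Q` to be
translation invariant (`sum_pderiv_eq_zero`). Along coordinate directions, `∂(eNorm h)/∂v_r` grows
at most linearly (`pderiv_pderiv_eNormDeriv`), so by induction each entry is affine in each
variable. A symmetric polynomial with both properties is constant (`exists_eq_C`). Then `T` is
constant as well, homogeneity kills its off-diagonal entries, and the normalization of `Q` makes the
diagonal `1` (`pointD_eq_of_constant`). -/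

namespace SymCoord

open Finset

/-! ### Restriction of polynomials to lines -/

section LineRestrict

variable {K ι : Type*} [CommRing K]

/-- The restriction of a polynomial to the line `t ↦ x + t w`, as a polynomial in `t`. -/
noncomputable def lineRestrict (x w : ι → K) : MvPolynomial ι K →ₐ[K] Polynomial K :=
  MvPolynomial.aeval fun i => Polynomial.C (x i) + Polynomial.X * Polynomial.C (w i)

theorem eval_lineRestrict (x w : ι → K) (f : MvPolynomial ι K) (t : K) :
    (lineRestrict x w f).eval t = MvPolynomial.eval (fun i => x i + t * w i) f := by
  induction f using MvPolynomial.induction_on with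
  | C a => simp [lineRestrict]
  | add p q hp hq => simp [hp, hq]
  | mul_X p i hp => rw [map_mul, Polynomial.eval_mul, hp]; simp [lineRestrict, mul_comm (w i)]

theorem eval_zero_lineRestrict (x w : ι → K) (f : MvPolynomial ι K) :
    (lineRestrict x w f).eval 0 = MvPolynomial.eval x f := by
  simp [eval_lineRestrict]

theorem derivative_lineRestrict [Fintype ι] [DecidableEq ι] (x w : ι → K)
    (f : MvPolynomial ι K) :
    Polynomial.derivative (lineRestrict x w f) =
      ∑ i, Polynomial.C (w i) * lineRestrict x w (MvPolynomial.pderiv i f) := by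
  induction f using MvPolynomial.induction_on with
  | C a => simp [lineRestrict]
  | add p q hp hq => simp [hp, hq, mul_add, sum_add_distrib]
  | mul_X p j hp =>
    rw [map_mul, Polynomial.derivative_mul, hp]
    have h1 : Polynomial.derivative (lineRestrict x w (MvPolynomial.X j)) =
        Polynomial.C (w j) := by
      simp [lineRestrict]
    rw [h1]
    simp only [MvPolynomial.pderiv_mul, map_add, map_mul, mul_add, sum_add_distrib]
    congr 1
    · rw [sum_mul]
      exact sum_congr rfl fun i _ => by ring
    · rw [sum_eq_single j]
      · simp [mul_comm]
      · intro i _ hij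
        rw [MvPolynomial.pderiv_X_of_ne hij.symm]; simp
      · simp

theorem derivative_lineRestrict_single [Fintype ι] [DecidableEq ι] (x : ι → K) (j : ι)
    (f : MvPolynomial ι K) :
    Polynomial.derivative (lineRestrict x (Pi.single j 1) f) =
      lineRestrict x (Pi.single j 1) (MvPolynomial.pderiv j f) := by
  rw [derivative_lineRestrict, sum_eq_single j]
  · simp
  · intro i _ hij
    simp [Pi.single_eq_of_ne hij]
  · simp

end LineRestrict

/-! ### Elementary symmetric polynomials as functions of one variable -/

section Esymm

variable {K : Type*} [Field K] {N : ℕ}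

theorem eval_esymm_eq_coeff (x : Fin N → K) {k : ℕ} (hk : k ≤ N) :
    MvPolynomial.eval x (MvPolynomial.esymm (Fin N) K k) =
      (∏ j, (Polynomial.X + Polynomial.C (x j))).coeff (N - k) := by
  rw [Finset.prod_X_add_C_coeff _ _ (by simp), MvPolynomial.esymm]
  simp [Nat.sub_sub_self hk]

theorem lineRestrict_single_esymm (x : Fin N → K) [Infinite K] (i : Fin N) {k : ℕ} (hk : k ≤ N) :
    lineRestrict x (Pi.single i 1) (MvPolynomial.esymm (Fin N) K k) =
      Polynomial.C (((Polynomial.X + Polynomial.C (x i)) *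
        ∏ j ∈ univ.erase i, (Polynomial.X + Polynomial.C (x j))).coeff (N - k)) +
      Polynomial.X * Polynomial.C
        ((∏ j ∈ univ.erase i, (Polynomial.X + Polynomial.C (x j))).coeff (N - k)) := by
  refine Polynomial.funext fun t => ?_
  rw [eval_lineRestrict, eval_esymm_eq_coeff _ hk, ← mul_prod_erase _ _ (mem_univ i)]
  have : ∏ j ∈ univ.erase i, (Polynomial.X + Polynomial.C (x j + t * (Pi.single i 1 : _ → K) j)) =
      ∏ j ∈ univ.erase i, (Polynomial.X + Polynomial.C (x j)) := by
    refine prod_congr rfl fun j hj => ?_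
    rw [Pi.single_eq_of_ne (ne_of_mem_erase hj)]; simp
  rw [this]
  simp [← add_assoc, add_mul _ (Polynomial.C t), mul_comm t]

/-- As a function of `x_i`, `e_k` is affine; its slope is `e_{k-1}` of the other variables, or `0`
if `k = 0`. -/
theorem eval_pderiv_esymm (x : Fin N → K) [Infinite K] (i : Fin N) {k : ℕ} (hk : k ≤ N) :
    MvPolynomial.eval x (MvPolynomial.pderiv i (MvPolynomial.esymm (Fin N) K k)) =
      (∏ j ∈ univ.erase i, (Polynomial.X + Polynomial.C (x j))).coeff (N - k) := by
  rw [← eval_zero_lineRestrict x (Pi.single i 1), ← derivative_lineRestrict_single,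
    lineRestrict_single_esymm x i hk]
  simp

theorem pderiv_pderiv_esymm [Infinite K] (i : Fin N) {k : ℕ} (hk : k ≤ N) :
    MvPolynomial.pderiv i (MvPolynomial.pderiv i (MvPolynomial.esymm (Fin N) K k)) = 0 := by
  refine MvPolynomial.funext fun x => ?_
  rw [← eval_zero_lineRestrict x (Pi.single i 1), ← derivative_lineRestrict_single,
    ← derivative_lineRestrict_single, lineRestrict_single_esymm x i hk]
  simp

end Esymm

/-! ### The operators `D_d` on polynomials -/

section

variable {𝕜 : Type*} [RCLike 𝕜] {N : ℕ}

theorem differentiable_eval {ι : Type*} [Fintype ι] (f : MvPolynomial ι 𝕜) :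
    Differentiable 𝕜 fun x : ι → 𝕜 => MvPolynomial.eval x f :=
  fun x => (AnalyticOnNhd.eval_mvPolynomial f x (Set.mem_univ x)).differentiableAt

theorem contDiff_eval {ι : Type*} [Fintype ι] (f : MvPolynomial ι 𝕜) :
    ContDiff 𝕜 1 fun x : ι → 𝕜 => MvPolynomial.eval x f :=
  (AnalyticOnNhd.eval_mvPolynomial f).contDiff

theorem partialAt_eval {ι : Type*} [Fintype ι] [DecidableEq ι] (f : MvPolynomial ι 𝕜) (i : ι)
    (x : ι → 𝕜) :
    partialAt (fun y => MvPolynomial.eval y f) i x =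
      MvPolynomial.eval x (MvPolynomial.pderiv i f) := by
  unfold partialAt
  induction f using MvPolynomial.induction_on with
  | C a => simp
  | add p q hp hq =>
    simp only [map_add]
    rw [fderiv_fun_add (differentiable_eval p x) (differentiable_eval q x)]
    simp [hp, hq]
  | mul_X p j hp =>
    simp only [map_mul, MvPolynomial.eval_X]
    rw [fderiv_fun_mul (differentiable_eval p x) (by fun_prop),
      (hasFDerivAt_apply j x).fderiv]
    by_cases h : j = i
    · subst h; simp [hp, mul_comm]
    · simp [hp, h, mul_comm]

/-- The coefficient of `∂_i` in the operator `D_d`, at the point `x`. -/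
noncomputable def weight (x : Fin N → 𝕜) (d : ℕ) (i : Fin N) : 𝕜 :=
  (d.factorial : 𝕜) * ∑ I ∈ powersetCard d (univ : Finset (Fin N)),
    if i ∈ I then (∏ j ∈ I.erase i, (x j - x i))⁻¹ else 0

theorem D_eq_sum_weight (d : ℕ) (φ : (Fin N → 𝕜) → 𝕜) (x : Fin N → 𝕜) :
    D d φ x = ∑ i, weight x d i * partialAt φ i x := by
  simp only [D, DSet, weight, mul_assoc, sum_mul]
  rw [← mul_sum, sum_comm]
  congr 1
  refine sum_congr rfl fun I _ => ?_
  simp only [ite_mul, zero_mul, sum_ite_mem, univ_inter]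
  exact sum_congr rfl fun i _ => by rw [div_eq_inv_mul]

theorem weight_add_const (x : Fin N → 𝕜) (t : 𝕜) (d : ℕ) (i : Fin N) :
    weight (fun j => x j + t) d i = weight x d i := by
  simp [weight]

/-- A set of `d + 1` indices gives `d` factors in each denominator. -/
theorem weight_smul (x : Fin N → 𝕜) {t : 𝕜} (ht : t ≠ 0) (d : ℕ) (i : Fin N) :
    t ^ d * weight (fun j => t * x j) (d + 1) i = weight x (d + 1) i := by
  simp only [weight]
  rw [mul_left_comm, mul_sum]
  congr 1
  refine sum_congr rfl fun I hI => ?_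
  split_ifs with hi
  · rw [mem_powersetCard] at hI
    simp only [← mul_sub, prod_mul_distrib, prod_const, card_erase_of_mem hi, hI.2,
      Nat.add_sub_cancel, mul_inv]
    rw [mul_inv_cancel_left₀ (pow_ne_zero _ ht)]
  · simp

/-- The operator `D_d` on polynomials, followed by evaluation at `x`. -/
noncomputable def pointD (x : Fin N → 𝕜) (d : ℕ) (f : MvPolynomial (Fin N) 𝕜) : 𝕜 :=
  ∑ i, weight x d i * MvPolynomial.eval x (MvPolynomial.pderiv i f)

theorem D_eval (d : ℕ) (f : MvPolynomial (Fin N) 𝕜) (x : Fin N → 𝕜) :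
    D d (fun y => MvPolynomial.eval y f) x = pointD x d f := by
  simp [D_eq_sum_weight, partialAt_eval, pointD]

theorem pointD_add (x : Fin N → 𝕜) (d : ℕ) (f g : MvPolynomial (Fin N) 𝕜) :
    pointD x d (f + g) = pointD x d f + pointD x d g := by
  simp [pointD, mul_add, sum_add_distrib]

theorem pointD_C (x : Fin N → 𝕜) (d : ℕ) (a : 𝕜) :
    pointD x d (MvPolynomial.C a) = 0 := by
  simp [pointD]

theorem pointD_mul (x : Fin N → 𝕜) (d : ℕ) (f g : MvPolynomial (Fin N) 𝕜) :
    pointD x d (f * g) = pointD x d f * MvPolynomial.eval x g +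
      MvPolynomial.eval x f * pointD x d g := by
  simp only [pointD, MvPolynomial.pderiv_mul, map_add, map_mul, mul_add, sum_add_distrib,
    sum_mul, mul_sum]
  congr 1 <;> exact sum_congr rfl fun i _ => by ring

theorem pointD_C_mul (x : Fin N → 𝕜) (d : ℕ) (a : 𝕜) (f : MvPolynomial (Fin N) 𝕜) :
    pointD x d (MvPolynomial.C a * f) = a * pointD x d f := by
  simp [pointD_mul, pointD_C]

/-- Lagrange interpolation of the constant `1` at the nodes `-x_j`. -/
theorem sum_prod_erase_eq {x : Fin N → 𝕜} (hx : Function.Injective x) {I : Finset (Fin N)}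
    (hI : I.Nonempty) :
    ∑ i ∈ I, Polynomial.C (∏ j ∈ I.erase i, (x j - x i))⁻¹ *
      ∏ j ∈ univ.erase i, (Polynomial.X + Polynomial.C (x j)) =
    ∏ j ∈ univ \ I, (Polynomial.X + Polynomial.C (x j)) := by
  have key := Lagrange.sum_basis (s := I) (v := fun j => -x j)
    ((neg_injective.comp hx).injOn) hI
  have : ∀ i ∈ I, Polynomial.C (∏ j ∈ I.erase i, (x j - x i))⁻¹ *
      ∏ j ∈ univ.erase i, (Polynomial.X + Polynomial.C (x j)) =
      (∏ j ∈ univ \ I, (Polynomial.X + Polynomial.C (x j))) *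
        Lagrange.basis I (fun j => -x j) i := by
    intro i hi
    have h1 : univ.erase i = (univ \ I) ∪ I.erase i := by
      ext j; by_cases hj : j ∈ I <;> simp [hj]
      rintro rfl; exact hj hi
    have h2 : Disjoint (univ \ I) (I.erase i) :=
      disjoint_left.2 fun j hj hj' => (mem_sdiff.1 hj).2 (mem_of_mem_erase hj')
    rw [h1, prod_union h2, Lagrange.basis, mul_left_comm]
    congr 1
    rw [← prod_inv_distrib, map_prod, ← prod_mul_distrib]
    refine prod_congr rfl fun j _ => ?_
    rw [Lagrange.basisDivisor]
    rw [map_neg, sub_neg_eq_add, sub_neg_eq_add, neg_add_eq_sub]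
  rw [sum_congr rfl this, ← mul_sum, key, mul_one]

/-- Differentiating a product of linear factors `d` times gives `d!` times the sum over the
`d`-subsets `I` of removed factors; interpolation at the nodes of `I` produces each summand. -/
theorem sum_weight_mul_prod_erase {x : Fin N → 𝕜} (hx : Function.Injective x) {d : ℕ}
    (hd : d ≠ 0) (hdN : d ≤ N) :
    ∑ i, Polynomial.C (weight x d i) *
      ∏ j ∈ univ.erase i, (Polynomial.X + Polynomial.C (x j)) =
    Polynomial.derivative^[d] (∏ j, (Polynomial.X + Polynomial.C (x j))) := by
  have hinj : Function.Injective fun j => -x j := neg_injective.comp hx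
  have h1 : ∏ j, (Polynomial.X + Polynomial.C (x j)) =
      ∏ a ∈ univ.image (fun j => -x j), (Polynomial.X - Polynomial.C a) := by
    rw [prod_image hinj.injOn]; simp
  have hcard : (univ.image fun j => -x j).card = N := by
    rw [card_image_of_injective _ hinj]; simp
  rw [h1, Polynomial.iterate_derivative_prod_X_sub_C (by rw [hcard]; exact hdN), hcard]
  have h2 : ∑ T ∈ powersetCard (N - d) (univ.image fun j => -x j),
      ∏ a ∈ T, (Polynomial.X - Polynomial.C a) =
      ∑ I ∈ powersetCard d (univ : Finset (Fin N)),
        ∏ j ∈ univ \ I, (Polynomial.X + Polynomial.C (x j)) := by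
    symm
    refine sum_bij' (fun I _ => (univ \ I).image fun j => -x j)
      (fun T _ => univ.filter fun j => -x j ∉ T) ?_ ?_ ?_ ?_ ?_
    · intro I hI
      rw [mem_powersetCard] at hI ⊢
      refine ⟨image_subset_image (subset_univ _), ?_⟩
      rw [card_image_of_injective _ hinj, card_sdiff_of_subset hI.1, hI.2]; simp
    · intro T hT
      rw [mem_powersetCard] at hT ⊢
      refine ⟨subset_univ _, ?_⟩
      have : (univ.filter fun j => -x j ∈ T).card = N - d := by
        rw [← hT.2, ← card_image_of_injective _ hinj]
        congr 1
        ext a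
        simp only [mem_image, mem_filter, mem_univ, true_and]
        constructor
        · rintro ⟨j, hj, rfl⟩; exact hj
        · intro ha
          obtain ⟨j, _, rfl⟩ := mem_image.1 (hT.1 ha)
          exact ⟨j, ha, rfl⟩
      have h3 := card_filter_add_card_filter_not (s := (univ : Finset (Fin N)))
        (fun j => -x j ∈ T)
      rw [this, card_univ, Fintype.card_fin] at h3
      omega
    · intro I _
      ext j
      simp [hx.eq_iff]
    · intro T hT
      rw [mem_powersetCard] at hT
      ext a
      simp only [mem_image, mem_sdiff, mem_filter, mem_univ, true_and, not_not]
      constructor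
      · rintro ⟨j, hj, rfl⟩; exact hj
      · intro ha
        obtain ⟨j, _, rfl⟩ := mem_image.1 (hT.1 ha)
        exact ⟨j, ha, rfl⟩
    · intro I _
      rw [prod_image hinj.injOn]; simp
  rw [h2]
  simp only [weight, map_mul, map_natCast, map_sum, mul_assoc, sum_mul]
  rw [← mul_sum, sum_comm]
  congr 1
  refine sum_congr rfl fun I hI => ?_
  rw [← sum_prod_erase_eq hx (card_pos.1 (by rw [(mem_powersetCard.1 hI).2]; omega))]
  rw [← sum_filter_add_sum_filter_not univ (· ∈ I), add_eq_left.2]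
  · rw [filter_mem_eq_inter, univ_inter]
    exact sum_congr rfl fun i hi => by rw [if_pos hi]
  · refine sum_eq_zero fun i hi => ?_
    rw [if_neg (mem_filter.1 hi).2]; simp

/-- Compare coefficients of `X ^ (N - k)` in the derivative identity. The normalization of `eNorm`
absorbs the factor `(N - k + d)! / (N - k)!` that differentiation produces. -/
theorem pointD_eNorm {x : Fin N → 𝕜} (hx : Function.Injective x) {d k : ℕ} (hd : d ≠ 0)
    (hdN : d ≤ N) (hk : k ≤ N) :
    pointD x d (eNorm 𝕜 N k) =
      if d ≤ k then MvPolynomial.eval x (eNorm 𝕜 N (k - d)) else 0 := by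
  have h : pointD x d (MvPolynomial.esymm (Fin N) 𝕜 k) =
      (Polynomial.derivative^[d] (∏ j, (Polynomial.X + Polynomial.C (x j)))).coeff (N - k) := by
    rw [← sum_weight_mul_prod_erase hx hd hdN, Polynomial.finsetSum_coeff, pointD]
    exact sum_congr rfl fun i _ => by rw [Polynomial.coeff_C_mul, eval_pderiv_esymm x i hk]
  rw [eNorm, pointD_C_mul, h, Polynomial.coeff_iterate_derivative]
  split_ifs with hdk
  · have e1 : N - (k - d) = N - k + d := by omega
    rw [eNorm, map_mul, eval_esymm_eq_coeff _ (by omega : k - d ≤ N), e1, nsmul_eq_mul,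
      MvPolynomial.eval_C, ← mul_assoc]
    congr 1
    have := Nat.factorial_mul_descFactorial (n := N - k + d) (k := d) (by omega)
    rw [Nat.add_sub_cancel] at this
    rw [← this]
    push_cast
    ring
  · rw [Polynomial.coeff_eq_zero_of_natDegree_lt]
    · simp
    · rw [Polynomial.natDegree_prod_of_monic _ _ fun j _ => Polynomial.monic_X_add_C _]
      simp; omega

end

/-! ### Multinomial expansion and partitions -/

section Log

variable {A : Type*} [CommRing A]

theorem multiset_prod_map_monomial (k : Multiset ℕ) (e : ℕ → A) :
    (k.map fun h => PowerSeries.monomial h (e h)).prod =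
      PowerSeries.monomial k.sum (k.map e).prod := by
  induction k using Multiset.induction_on with
  | empty => simp
  | cons a s ih => simp [ih, PowerSeries.monomial_mul_monomial]

theorem coeff_sum_monomial_pow (e : ℕ → A) (N l r : ℕ) :
    PowerSeries.coeff r ((∑ h ∈ Icc 1 N, PowerSeries.monomial h (e h)) ^ l) =
      ∑ k ∈ (Icc 1 N).sym l with k.val.sum = r, (k.val.countPerms : A) * (k.val.map e).prod := by
  rw [Finset.sum_pow, map_sum, sum_filter]
  refine sum_congr rfl fun k _ => ?_
  rw [multiset_prod_map_monomial, ← nsmul_eq_mul, map_nsmul, PowerSeries.coeff_monomial]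
  split_ifs with h1 h2 h2
  · rw [nsmul_eq_mul]
  · exact absurd h1.symm h2
  · exact absurd h2.symm h1
  · simp

theorem countPerms_mul_prod_factorial {r : ℕ} (p : Nat.Partition r) :
    (∏ h ∈ Icc 1 r, (p.parts.count h).factorial) * p.parts.countPerms =
      p.parts.card.factorial := by
  have hsub : p.parts.toFinsupp.support ⊆ Icc 1 r := by
    intro h hh
    rw [Multiset.toFinsupp_support, Multiset.mem_toFinset] at hh
    rw [mem_Icc]
    exact ⟨p.parts_pos hh, p.parts_sum ▸ Multiset.single_le_sum (fun _ _ => Nat.zero_le _) _ hh⟩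
  rw [Multiset.countPerms, Finsupp.multinomial_eq_of_support_subset hsub]
  have := Nat.multinomial_spec (Icc 1 r) p.parts.toFinsupp
  simp only [Multiset.toFinsupp_apply] at this
  rw [this, Multiset.sum_count_eq_card]
  intro h hh
  exact hsub (by simpa using hh)

/-- Partitions are grouped by their number of parts `l + 1`; since `r ≤ N`, bounding parts and `l +
1` by `N` loses nothing. -/
theorem sum_partition_eq {r N : ℕ} (hr : r ≠ 0) (hrN : r ≤ N) (f : Multiset ℕ → A) :
    ∑ p : Nat.Partition r, f p.parts =
      ∑ l ∈ range N, ∑ k ∈ (Icc 1 N).sym (l + 1) with k.val.sum = r, f k.val := by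
  have hcard : ∀ p : Nat.Partition r, p.parts.card ≤ r := fun p => by
    have := Multiset.card_nsmul_le_sum (s := p.parts) (a := 1) fun _ h => p.parts_pos h
    simpa [p.parts_sum] using this
  have hpos : ∀ p : Nat.Partition r, 0 < p.parts.card := fun p => by
    rw [Multiset.card_pos]
    intro h
    have := p.parts_sum
    rw [h] at this
    exact hr (by simpa using this.symm)
  rw [← sum_fiberwise_of_maps_to (s := univ) (t := range N) (g := fun p => p.parts.card - 1)
    fun p _ => mem_range.2 (by have := hcard p; have := hpos p; omega)]
  refine sum_congr rfl fun l _ => ?_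
  refine sum_bij'
    (fun p hp => (⟨p.parts, by
      have := (mem_filter.1 hp).2; have := hpos p; omega⟩ : Sym ℕ (l + 1)))
    (fun k hk => ⟨k.val, fun {i} hi => (mem_Icc.1 (mem_sym_iff.1 (mem_filter.1 hk).1 i hi)).1,
      (mem_filter.1 hk).2⟩) ?_ ?_ ?_ ?_ ?_
  · intro p hp
    refine mem_filter.2 ⟨mem_sym_iff.2 fun a ha => ?_, p.parts_sum⟩
    have ha' : a ∈ p.parts := ha
    rw [mem_Icc]
    exact ⟨p.parts_pos ha', le_trans
      (p.parts_sum ▸ Multiset.single_le_sum (fun _ _ => Nat.zero_le _) _ ha') hrN⟩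
  · intro k hk
    rw [mem_filter]
    exact ⟨mem_univ _, by simp⟩
  · intro p hp; rfl
  · intro k hk; rfl
  · intro p hp; rfl

end Log

/-! ### The `u_r` as coefficients of a logarithm -/

section

variable {𝕜 : Type*} [RCLike 𝕜] {N : ℕ}

/-- The generating series `∑_{h = 1}^N (eNorm h) t^h`. -/
noncomputable def eSeries (𝕜 : Type*) [RCLike 𝕜] (N : ℕ) :
    PowerSeries (MvPolynomial (Fin N) 𝕜) :=
  ∑ h ∈ Icc 1 N, PowerSeries.monomial h (eNorm 𝕜 N h)

theorem coeff_eSeries (h : ℕ) :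
    PowerSeries.coeff h (eSeries 𝕜 N) = if h ∈ Icc 1 N then eNorm 𝕜 N h else 0 := by
  simp [eSeries, PowerSeries.coeff_monomial]

/-- `u_r` is a coefficient of the logarithm of the generating series of the `eNorm h`. -/
theorem u_eq_coeff_log {r : ℕ} (hr : r ≠ 0) (hrN : r ≤ N) :
    u 𝕜 N r = ∑ l ∈ range N, MvPolynomial.C ((-1 : 𝕜) ^ l / ((l + 1 : ℕ) : 𝕜)) *
      PowerSeries.coeff r (eSeries 𝕜 N ^ (l + 1)) := by
  simp only [eSeries, coeff_sum_monomial_pow, mul_sum]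
  have h1 : u 𝕜 N r = ∑ p : Nat.Partition r, MvPolynomial.C
      ((-1 : 𝕜) ^ (p.parts.card - 1) / (p.parts.card : 𝕜)) *
        ((p.parts.countPerms : MvPolynomial (Fin N) 𝕜) * (p.parts.map (eNorm 𝕜 N)).prod) := by
    refine sum_congr rfl fun p _ => ?_
    rw [← mul_assoc, ← map_natCast (MvPolynomial.C (σ := Fin N) (R := 𝕜)), ← map_mul]
    congr 2
    have h2 := countPerms_mul_prod_factorial p
    have h3 : p.parts.card ≠ 0 := fun h => by
      have := p.parts_sum
      rw [Multiset.card_eq_zero.1 h] at this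
      exact hr (by simpa using this.symm)
    have h4 : ((p.parts.card.factorial : ℕ) : 𝕜) =
        (p.parts.card : 𝕜) * ((p.parts.card - 1).factorial : 𝕜) := by
      rw [← Nat.cast_mul, Nat.mul_factorial_pred h3]
    have h5 : (∏ h ∈ Icc 1 r, ((p.parts.count h).factorial : 𝕜)) ≠ 0 :=
      prod_ne_zero_iff.2 fun h _ => Nat.cast_ne_zero.2 (Nat.factorial_ne_zero _)
    have h6 : (p.parts.card : 𝕜) ≠ 0 := Nat.cast_ne_zero.2 h3
    rw [← h2] at h4
    push_cast at h4
    rw [div_mul_eq_mul_div, div_eq_div_iff h5 h6]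
    linear_combination (-(-1 : 𝕜) ^ (p.parts.card - 1)) * h4
  rw [h1, sum_partition_eq hr hrN (fun k => MvPolynomial.C
      ((-1 : 𝕜) ^ (k.card - 1) / (k.card : 𝕜)) *
        ((k.countPerms : MvPolynomial (Fin N) 𝕜) * (k.map (eNorm 𝕜 N)).prod))]
  refine sum_congr rfl fun l _ => sum_congr rfl fun k _ => ?_
  have : Multiset.card k.val = l + 1 := k.2
  rw [this, Nat.add_sub_cancel]

/-- The operator `pointD` applied to the coefficients of a power series. -/
noncomputable def seriesD (x : Fin N → 𝕜) (d : ℕ) (f : PowerSeries (MvPolynomial (Fin N) 𝕜)) :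
    PowerSeries 𝕜 :=
  PowerSeries.mk fun n => pointD x d (PowerSeries.coeff n f)

theorem pointD_zero (x : Fin N → 𝕜) (d : ℕ) : pointD x d 0 = 0 := by
  simp [pointD]

theorem pointD_sum (x : Fin N → 𝕜) (d : ℕ) {ι : Type*} (s : Finset ι)
    (f : ι → MvPolynomial (Fin N) 𝕜) :
    pointD x d (∑ i ∈ s, f i) = ∑ i ∈ s, pointD x d (f i) := by
  classical
  induction s using Finset.induction_on with
  | empty => simp [pointD_zero]
  | insert a s ha ih => rw [sum_insert ha, sum_insert ha, pointD_add, ih]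

theorem seriesD_mul (x : Fin N → 𝕜) (d : ℕ) (f g : PowerSeries (MvPolynomial (Fin N) 𝕜)) :
    seriesD x d (f * g) = seriesD x d f * PowerSeries.map (MvPolynomial.eval x) g +
      PowerSeries.map (MvPolynomial.eval x) f * seriesD x d g := by
  ext n
  simp only [seriesD, PowerSeries.coeff_mk, PowerSeries.coeff_mul, pointD_sum, pointD_mul,
    map_add, PowerSeries.coeff_map, sum_add_distrib]

theorem seriesD_pow_succ (x : Fin N → 𝕜) (d : ℕ) (f : PowerSeries (MvPolynomial (Fin N) 𝕜))
    (l : ℕ) :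
    seriesD x d (f ^ (l + 1)) = PowerSeries.C ((l + 1 : ℕ) : 𝕜) *
      (PowerSeries.map (MvPolynomial.eval x) f ^ l * seriesD x d f) := by
  induction l with
  | zero => simp
  | succ l ih =>
    rw [pow_succ, seriesD_mul, ih]
    push_cast
    simp only [map_add, map_pow, map_natCast, map_one]
    ring

/-- Formally, `D_d log E = D_d E / E = t ^ d` for the generating series `E = 1 + eSeries`. Both the
series and the logarithm are truncated, so equality is only claimed in orders `r ≤ N`. -/
theorem pointD_u {x : Fin N → 𝕜} (hx : Function.Injective x) {d r : ℕ} (hd : d ≠ 0)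
    (hdN : d ≤ N) (hr : r ≠ 0) (hrN : r ≤ N) :
    pointD x d (u 𝕜 N r) = if r = d then 1 else 0 := by
  set G := PowerSeries.map (MvPolynomial.eval x) (eSeries 𝕜 N) with hG
  have hG0 : PowerSeries.X ∣ G := by
    rw [PowerSeries.X_dvd_iff, hG, ← PowerSeries.coeff_zero_eq_constantCoeff_apply,
      PowerSeries.coeff_map, coeff_eSeries]
    simp
  have he0 : MvPolynomial.eval x (eNorm 𝕜 N 0) = 1 := by
    simp [eNorm, Nat.cast_ne_zero.2 (Nat.factorial_ne_zero N)]
  have hE : ∀ h ≤ N, PowerSeries.coeff h (seriesD x d (eSeries 𝕜 N)) =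
      PowerSeries.coeff h (PowerSeries.X ^ d * (1 + G)) := by
    intro h hh
    rw [seriesD, PowerSeries.coeff_mk, coeff_eSeries, PowerSeries.coeff_X_pow_mul']
    by_cases h0 : h = 0
    · subst h0; simp [pointD_zero, hd]
    rw [if_pos (mem_Icc.2 ⟨by omega, hh⟩), pointD_eNorm hx hd hdN hh]
    refine if_congr Iff.rfl ?_ rfl
    rw [map_add, PowerSeries.coeff_one, hG, PowerSeries.coeff_map, coeff_eSeries]
    by_cases h1 : h - d = 0
    · simp [h1, he0]
    · rw [if_neg h1, if_pos (mem_Icc.2 ⟨by omega, by omega⟩), zero_add]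
  have h1 : pointD x d (u 𝕜 N r) = PowerSeries.coeff r
      ((∑ l ∈ range N, (-G) ^ l) * seriesD x d (eSeries 𝕜 N)) := by
    rw [u_eq_coeff_log hr hrN, pointD_sum, sum_mul, map_sum]
    refine sum_congr rfl fun l _ => ?_
    have h2 : pointD x d (PowerSeries.coeff r (eSeries 𝕜 N ^ (l + 1))) =
        PowerSeries.coeff r (seriesD x d (eSeries 𝕜 N ^ (l + 1))) := by
      rw [seriesD, PowerSeries.coeff_mk]
    have h3 : (-G) ^ l = PowerSeries.C ((-1 : 𝕜) ^ l) * G ^ l := by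
      rw [neg_pow]; simp
    rw [pointD_C_mul, h2, seriesD_pow_succ, PowerSeries.coeff_C_mul, h3, mul_assoc,
      PowerSeries.coeff_C_mul, ← mul_assoc, div_mul_cancel₀ _ (Nat.cast_ne_zero.2 l.succ_ne_zero)]
  have h4 : PowerSeries.coeff r ((∑ l ∈ range N, (-G) ^ l) * seriesD x d (eSeries 𝕜 N)) =
      PowerSeries.coeff r ((∑ l ∈ range N, (-G) ^ l) * (PowerSeries.X ^ d * (1 + G))) := by
    rw [PowerSeries.coeff_mul, PowerSeries.coeff_mul]
    refine sum_congr rfl fun ij hij => ?_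
    rw [hE _ (by have := mem_antidiagonal.1 hij; omega)]
  have h5 : (∑ l ∈ range N, (-G) ^ l) * (PowerSeries.X ^ d * (1 + G)) =
      PowerSeries.X ^ d - PowerSeries.X ^ d * (-G) ^ N := by
    have := geom_sum_mul_neg (-G) N
    rw [sub_neg_eq_add] at this
    rw [mul_left_comm, this]
    ring
  -- The truncation error starts in order `d + N`, beyond `r` because `d ≥ 1`.
  have h6 : PowerSeries.X ^ (d + N) ∣ PowerSeries.X ^ d * (-G) ^ N := by
    rw [pow_add]
    exact mul_dvd_mul_left _ (pow_dvd_pow_of_dvd ((dvd_neg).2 hG0) _)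
  rw [h1, h4, h5, map_sub, PowerSeries.X_pow_dvd_iff.1 h6 r (by omega), sub_zero,
    PowerSeries.coeff_X_pow]

end

/-! ### Criteria for a polynomial to be constant or zero -/

section Coeff

variable {K ι : Type*} [Field K]

theorem eq_C_of_pderiv_eq_zero [CharZero K] {f : MvPolynomial ι K}
    (h : ∀ i, MvPolynomial.pderiv i f = 0) : f = MvPolynomial.C (MvPolynomial.coeff 0 f) := by
  classical
  ext m
  rw [MvPolynomial.coeff_C]
  split_ifs with hm
  · rw [hm]
  · obtain ⟨i, hi⟩ := Finsupp.ne_iff.1 (Ne.symm hm)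
    have h1 := congrArg (MvPolynomial.coeff (m - Finsupp.single i 1)) (h i)
    rw [MvPolynomial.coeff_pderiv, MvPolynomial.coeff_zero, tsub_add_cancel_of_le
      (Finsupp.single_le_iff.2 (Nat.one_le_iff_ne_zero.2 hi))] at h1
    exact (mul_eq_zero.1 h1).resolve_right (Nat.cast_add_one_ne_zero _)

theorem coeff_eq_zero_of_pderiv_pderiv [CharZero K] {f : MvPolynomial ι K} {i : ι}
    (h : MvPolynomial.pderiv i (MvPolynomial.pderiv i f) = 0) {m : ι →₀ ℕ} (hm : 2 ≤ m i) :
    MvPolynomial.coeff m f = 0 := by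
  have h1 := congrArg (MvPolynomial.coeff (m - Finsupp.single i 2)) h
  rw [MvPolynomial.coeff_pderiv, MvPolynomial.coeff_pderiv, MvPolynomial.coeff_zero, add_assoc,
    ← Finsupp.single_add, tsub_add_cancel_of_le (Finsupp.single_le_iff.2 hm)] at h1
  have h2 := (mul_eq_zero.1 h1).resolve_right (Nat.cast_add_one_ne_zero _)
  exact (mul_eq_zero.1 h2).resolve_right (Nat.cast_add_one_ne_zero _)

/-- A symmetric polynomial that is affine in each variable and invariant under simultaneous
translation of the variables is constant. -/
theorem eq_C_of_symmetric_of_affine_of_translation [CharZero K] [Fintype ι] [DecidableEq ι]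
    {f : MvPolynomial ι K} (hsymm : f.IsSymmetric)
    (haff : ∀ i, MvPolynomial.pderiv i (MvPolynomial.pderiv i f) = 0)
    (htrans : ∑ i, MvPolynomial.pderiv i f = 0) :
    f = MvPolynomial.C (MvPolynomial.coeff 0 f) := by
  ext s
  rw [MvPolynomial.coeff_C]
  split_ifs with hs
  · rw [hs]
  obtain ⟨i, hi⟩ := Finsupp.ne_iff.1 (Ne.symm hs)
  by_cases hi2 : 2 ≤ s i
  · exact coeff_eq_zero_of_pderiv_pderiv (haff i) hi2
  have hi1 : s i = 1 := by
    have : s i ≠ 0 := hi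
    omega
  set T := s - Finsupp.single i 1 with hT
  have hsT : T + Finsupp.single i 1 = s :=
    tsub_add_cancel_of_le (Finsupp.single_le_iff.2 hi1.ge)
  have hTi : T i = 0 := by simp [hT, hi1]
  -- If `j` does not occur in `T`, the swap of `i` and `j` carries the monomial `s` to `T` times
  -- `x_j`; if it occurs, affinity kills the coefficient. So the coefficient of `∑ ∂_j f` at `T` is
  -- a positive integer times that of `f` at `s`.
  have key : ∀ j, MvPolynomial.coeff T (MvPolynomial.pderiv j f) =
      if T j = 0 then MvPolynomial.coeff s f else 0 := by
    intro j
    rw [MvPolynomial.coeff_pderiv]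
    split_ifs with hj
    · have h1 : (T + Finsupp.single i 1).mapDomain (Equiv.swap i j) =
          T + Finsupp.single j 1 := by
        rw [Finsupp.mapDomain_add, Finsupp.mapDomain_single, Equiv.swap_apply_left]
        congr 1
        ext a
        rw [← Finsupp.equivMapDomain_eq_mapDomain, Finsupp.equivMapDomain_apply, Equiv.symm_swap]
        by_cases h2 : a = i
        · rw [h2, Equiv.swap_apply_left, hTi, hj]
        by_cases h3 : a = j
        · rw [h3, Equiv.swap_apply_right, hTi, hj]
        rw [Equiv.swap_apply_of_ne_of_ne h2 h3]
      have h4 := MvPolynomial.coeff_rename_mapDomain (Equiv.swap i j)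
        (Equiv.injective _) f (T + Finsupp.single i 1)
      rw [hsymm, h1, hsT] at h4
      rw [h4, hj]; simp
    · rw [coeff_eq_zero_of_pderiv_pderiv (haff j), zero_mul]
      simp only [Finsupp.add_apply, Finsupp.single_eq_same]
      omega
  have h5 := congrArg (MvPolynomial.coeff T) htrans
  rw [MvPolynomial.coeff_sum, MvPolynomial.coeff_zero, sum_congr rfl fun j _ => key j,
    ← sum_filter, sum_const, nsmul_eq_mul] at h5
  refine (mul_eq_zero.1 h5).resolve_left (Nat.cast_ne_zero.2 (card_ne_zero.2 ⟨i, ?_⟩))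
  simp [hTi]

theorem pderiv_pderiv_comm (i j : ι) (f : MvPolynomial ι K) :
    MvPolynomial.pderiv i (MvPolynomial.pderiv j f) =
      MvPolynomial.pderiv j (MvPolynomial.pderiv i f) := by
  ext m
  simp only [MvPolynomial.coeff_pderiv, add_right_comm m]
  by_cases h : i = j
  · rw [h]
  · simp [h, Ne.symm h]; ring

/-- A polynomial whose value is nonzero exactly at the points with distinct coordinates. -/
noncomputable def distinctPoly (K ι : Type*) [Field K] [Fintype ι] [DecidableEq ι] :
    MvPolynomial ι K :=
  ∏ i, ∏ j ∈ univ.erase i, (MvPolynomial.X i - MvPolynomial.X j)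

theorem eval_distinctPoly_ne_zero [Fintype ι] [DecidableEq ι] {x : ι → K} :
    MvPolynomial.eval x (distinctPoly K ι) ≠ 0 ↔ Function.Injective x := by
  simp only [distinctPoly, map_prod, prod_ne_zero_iff, mem_univ, forall_const, mem_erase,
    map_sub, MvPolynomial.eval_X, sub_ne_zero]
  constructor
  · intro h i j hij
    by_contra hne
    exact h i j ⟨Ne.symm hne, trivial⟩ hij
  · intro h i j hij
    exact h.ne hij.1.symm

theorem distinctPoly_ne_zero [Fintype ι] [DecidableEq ι] : distinctPoly K ι ≠ 0 := by
  refine prod_ne_zero_iff.2 fun i _ => prod_ne_zero_iff.2 fun j hj => sub_ne_zero.2 fun h => ?_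
  exact (ne_of_mem_erase hj) (MvPolynomial.X_injective h).symm

theorem eq_zero_of_eval_eq_zero [Infinite K] {f g : MvPolynomial ι K} (hg : g ≠ 0)
    (h : ∀ x, MvPolynomial.eval x g ≠ 0 → MvPolynomial.eval x f = 0) : f = 0 := by
  have : g * f = 0 := MvPolynomial.funext fun x => by
    by_cases hx : MvPolynomial.eval x g = 0
    · simp [hx]
    · simp [h x hx]
  exact (mul_eq_zero.1 this).resolve_left hg

end Coeff

/-! ### Growth of one-variable polynomials at infinity -/

section Growth

open Asymptotics Bornology Filter Polynomial

variable {𝕜 : Type*} [RCLike 𝕜]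

theorem eventually_eval_ne_zero {p : 𝕜[X]} (hp : p ≠ 0) :
    ∀ᶠ t in cobounded 𝕜, p.eval t ≠ 0 := by
  have : (p.rootSet 𝕜).Finite := p.rootSet_finite 𝕜
  filter_upwards [isBounded_def.1 this.isBounded] with t ht h
  exact ht ((mem_rootSet.2 ⟨hp, by simpa using h⟩))

theorem tendsto_norm_eval_cobounded {p : 𝕜[X]} (hp : 0 < p.degree) :
    Tendsto (fun t => ‖p.eval t‖) (cobounded 𝕜) atTop :=
  p.tendsto_norm_atTop hp tendsto_norm_cobounded_atTop

/-- The case `p = 0`, where the inverse is `0` by convention, is included: a denominator may vanish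
identically on a line. -/
theorem inv_eval_isBigO_one (p : 𝕜[X]) :
    (fun t => (p.eval t)⁻¹) =O[cobounded 𝕜] (fun _ => (1 : 𝕜)) := by
  by_cases hd : 0 < p.degree
  · have := tendsto_norm_atTop_iff_cobounded.1 (tendsto_norm_eval_cobounded hd)
    exact (tendsto_inv₀_cobounded.comp this).isBigO_one 𝕜
  · rw [eq_C_of_degree_le_zero (not_lt.1 hd)]
    simp only [eval_C]
    exact isBigO_const_const _ one_ne_zero _

theorem eq_C_of_eval_isBigO_one {p : 𝕜[X]}
    (h : (fun t => p.eval t) =O[cobounded 𝕜] (fun _ => (1 : 𝕜))) : p = C (p.coeff 0) := by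
  by_contra hne
  have hd : 0 < p.degree := by
    by_contra hd
    exact hne (eq_C_of_degree_le_zero (not_lt.1 hd))
  have h1 := (isBigO_one_iff 𝕜).1 h
  exact not_isBoundedUnder_of_tendsto_atTop (tendsto_norm_eval_cobounded hd) h1

theorem eval_isBigO_id {p : 𝕜[X]} (h : derivative (derivative p) = 0) :
    (fun t => p.eval t) =O[cobounded 𝕜] (fun t => t) := by
  have h1 : p.natDegree ≤ 1 := by
    have := Polynomial.derivative_eq_zero.1 h
    rw [natDegree_derivative] at this
    omega
  have hone : (fun _ : 𝕜 => (1 : 𝕜)) =O[cobounded 𝕜] (fun t => t) := by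
    refine IsBigO.of_bound 1 ?_
    filter_upwards [tendsto_norm_cobounded_atTop.eventually_ge_atTop 1] with t ht
    simpa using ht
  rw [eq_X_add_C_of_natDegree_le_one h1]
  simp only [eval_add, eval_mul, eval_C, eval_X]
  exact ((isBigO_refl _ _).const_mul_left _).add
    ((isBigO_const_const _ one_ne_zero _).trans hone)

/-- Subtracting the constant term and dividing by `t` reduces linear growth to boundedness of
`p.divX`. -/
theorem derivative_derivative_eq_zero_of_isBigO {p : 𝕜[X]}
    (h : (fun t => p.eval t) =O[cobounded 𝕜] (fun t => t)) :
    derivative (derivative p) = 0 := by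
  have h0 : derivative (derivative (X : 𝕜[X])) = 0 := by simp
  have h1 : (fun t => p.divX.eval t * t) =O[cobounded 𝕜] (fun t => t) := by
    have : (fun t => p.divX.eval t * t) = fun t => p.eval t - (C (p.coeff 0)).eval t := by
      ext t
      nth_rewrite 2 [← divX_mul_X_add p]
      simp
    rw [this]
    exact h.sub (eval_isBigO_id (by simp))
  have h2 : (fun t => p.divX.eval t) =O[cobounded 𝕜] (fun _ => (1 : 𝕜)) := by
    have h3 := h1.mul (isBigO_refl (fun t : 𝕜 => t⁻¹) (cobounded 𝕜))
    refine h3.congr' ?_ ?_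
    all_goals
      filter_upwards [eventually_ne_cobounded (0 : 𝕜)] with t ht
      field_simp
  rw [← divX_mul_X_add p, eq_C_of_eval_isBigO_one h2]
  simp

end Growth

/-! ### Homogeneous polynomials under scaling -/

section Homogeneous

variable {K ι : Type*} [Field K]

theorem isHomogeneous_pderiv {f : MvPolynomial ι K} {n : ℕ} (hf : f.IsHomogeneous (n + 1))
    (i : ι) : (MvPolynomial.pderiv i f).IsHomogeneous n := by
  intro m hm
  rw [MvPolynomial.coeff_pderiv] at hm
  have := hf (left_ne_zero_of_mul hm)
  rw [map_add] at this
  simpa [Finsupp.weight_single] using this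

theorem eval_mul_of_isHomogeneous [Fintype ι] {f : MvPolynomial ι K} {n : ℕ}
    (hf : f.IsHomogeneous n) (x : ι → K) (t : K) :
    MvPolynomial.eval (fun i => t * x i) f = t ^ n * MvPolynomial.eval x f := by
  rw [MvPolynomial.eval_eq', MvPolynomial.eval_eq', mul_sum]
  refine sum_congr rfl fun m hm => ?_
  have h1 := hf (MvPolynomial.mem_support_iff.1 hm)
  have h2 : ∑ i, m i = n := by
    rw [← h1, Finsupp.weight_apply, Finsupp.sum_fintype _ _ (by simp)]; simp
  simp only [mul_pow, prod_mul_distrib, prod_pow_eq_pow_sum, h2]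
  ring

end Homogeneous

/-! ### Consequences of homogeneity and of the two hypotheses -/

section

variable {𝕜 : Type*} [RCLike 𝕜] {N : ℕ}

/-- This is homogeneity of degree `k - d`, written without negative exponents. -/
theorem pointD_smul_of_isHomogeneous {f : MvPolynomial (Fin N) 𝕜} {k : ℕ}
    (hf : f.IsHomogeneous (k + 1)) (x : Fin N → 𝕜) {t : 𝕜} (ht : t ≠ 0) (d : ℕ) :
    t ^ d * pointD (fun j => t * x j) (d + 1) f = t ^ k * pointD x (d + 1) f := by
  simp only [pointD, mul_sum]
  refine sum_congr rfl fun i _ => ?_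
  rw [← mul_assoc, weight_smul x ht, eval_mul_of_isHomogeneous (isHomogeneous_pderiv hf i)]
  ring

theorem eval_eNorm (x : Fin N → 𝕜) (h : ℕ) : MvPolynomial.eval x (eNorm 𝕜 N h) =
    ((N - h).factorial : 𝕜) / (N.factorial : 𝕜) *
      MvPolynomial.eval x (MvPolynomial.esymm (Fin N) 𝕜 h) := by
  simp [eNorm]

theorem eNorm_zero : eNorm 𝕜 N 0 = 1 := by
  simp [eNorm, Nat.cast_ne_zero.2 (Nat.factorial_ne_zero N)]

theorem isSymmetric_eNorm (h : ℕ) : (eNorm 𝕜 N h).IsSymmetric :=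
  (MvPolynomial.IsSymmetric.C _).mul (MvPolynomial.esymm_isSymmetric _ _ _)

theorem pderiv_pderiv_eNorm (i : Fin N) {h : ℕ} (hh : h ≤ N) :
    MvPolynomial.pderiv i (MvPolynomial.pderiv i (eNorm 𝕜 N h)) = 0 := by
  rw [eNorm, MvPolynomial.pderiv_C_mul, MvPolynomial.pderiv_C_mul, pderiv_pderiv_esymm i hh,
    mul_zero]

theorem esymm_eq_C_mul_eNorm (h : ℕ) : MvPolynomial.esymm (Fin N) 𝕜 h =
    MvPolynomial.C ((N.factorial : 𝕜) / ((N - h).factorial : 𝕜)) * eNorm 𝕜 N h := by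
  rw [eNorm, ← mul_assoc, ← map_mul, div_mul_div_cancel₀
    (Nat.cast_ne_zero.2 (Nat.factorial_ne_zero _)),
    div_self (Nat.cast_ne_zero.2 (Nat.factorial_ne_zero _)), map_one, one_mul]

/-- `D_d` maps symmetric polynomials to symmetric polynomials. -/
theorem exists_symmetric_pointD {f : MvPolynomial (Fin N) 𝕜} (hf : f.IsSymmetric) {d : ℕ}
    (hd : d ≠ 0) (hdN : d ≤ N) :
    ∃ g : MvPolynomial.symmetricSubalgebra (Fin N) 𝕜, ∀ x : Fin N → 𝕜, Function.Injective x →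
      pointD x d f = MvPolynomial.eval x g.1 := by
  -- As `D_d` is a derivation, it suffices to know it on the generators `e_1, …, e_N`.
  obtain ⟨p, hp⟩ := MvPolynomial.esymmAlgHom_surjective (σ := Fin N) 𝕜 (n := N) (by simp)
    ⟨f, hf⟩
  have hp' : f = MvPolynomial.aeval
      (fun i : Fin N => MvPolynomial.esymm (Fin N) 𝕜 (i + 1)) p := by
    rw [← MvPolynomial.esymmAlgHom_apply, hp]
  rw [hp']
  clear hp hp' hf f
  induction p using MvPolynomial.induction_on with
  | C a =>
    exact ⟨0, fun x _ => by simp [MvPolynomial.algebraMap_eq, pointD_C]⟩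
  | add p q hp hq =>
    obtain ⟨g, hg⟩ := hp
    obtain ⟨g', hg'⟩ := hq
    exact ⟨g + g', fun x hx => by rw [map_add, pointD_add, hg x hx, hg' x hx]; simp⟩
  | mul_X p i hp =>
    obtain ⟨g, hg⟩ := hp
    have he : ∃ e : MvPolynomial.symmetricSubalgebra (Fin N) 𝕜, ∀ x : Fin N → 𝕜,
        Function.Injective x →
        pointD x d (MvPolynomial.esymm (Fin N) 𝕜 (i + 1)) = MvPolynomial.eval x e.1 := by
      refine ⟨if d ≤ (i : ℕ) + 1 then ⟨MvPolynomial.C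
        ((N.factorial : 𝕜) / ((N - (i + 1)).factorial : 𝕜)) * eNorm 𝕜 N (i + 1 - d),
        (MvPolynomial.IsSymmetric.C _).mul (isSymmetric_eNorm _)⟩ else 0, fun x hx => ?_⟩
      rw [esymm_eq_C_mul_eNorm, pointD_C_mul, pointD_eNorm hx hd hdN (by omega)]
      split_ifs
      · simp
      · simp
    obtain ⟨e, he⟩ := he
    have hs : (MvPolynomial.aeval
        (fun i : Fin N => MvPolynomial.esymm (Fin N) 𝕜 (i + 1)) p).IsSymmetric := by
      rw [← MvPolynomial.esymmAlgHom_apply]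
      exact (MvPolynomial.esymmAlgHom (Fin N) 𝕜 N p).2
    refine ⟨g * ⟨MvPolynomial.esymm (Fin N) 𝕜 (i + 1), MvPolynomial.esymm_isSymmetric _ _ _⟩ +
      ⟨_, hs⟩ * e, fun x hx => ?_⟩
    rw [map_mul, MvPolynomial.aeval_X, pointD_mul, hg x hx, he x hx]
    simp

/-- If `g(t x) = t^{k - d} g(x)` for all `t ≠ 0`, then `g(x) = 0` when `k < d`, and
`g(x) = g(0)` when `k = d`. -/
theorem eval_eq_of_scaling {ι : Type*} {K : Type*} [Field K] [Infinite K]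
    {g : MvPolynomial ι K} {d k : ℕ} {x : ι → K}
    (h : ∀ t : K, t ≠ 0 →
      t ^ d * MvPolynomial.eval (fun j => t * x j) g = t ^ k * MvPolynomial.eval x g)
    (hkd : k ≤ d) :
    MvPolynomial.eval x g = if k = d then MvPolynomial.eval 0 g else 0 := by
  set τ := lineRestrict 0 x g with hτ
  -- The extra factor `X` makes the identity trivial at `t = 0`, where `h` says nothing.
  have h1 : Polynomial.X * (Polynomial.X ^ d * τ) =
      Polynomial.X * (Polynomial.X ^ k * Polynomial.C (MvPolynomial.eval x g)) := by
    refine Polynomial.funext fun t => ?_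
    by_cases ht : t = 0
    · simp [ht]
    · simp only [Polynomial.eval_mul, Polynomial.eval_pow, Polynomial.eval_X, Polynomial.eval_C,
        hτ, eval_lineRestrict, Pi.zero_apply, zero_add]
      rw [h t ht]
  have h2 := congrArg (fun p => Polynomial.coeff p k) (mul_left_cancel₀ Polynomial.X_ne_zero h1)
  simp only [Polynomial.coeff_X_pow_mul', le_refl, if_true, Nat.sub_self,
    Polynomial.coeff_C_zero] at h2
  rw [← h2]
  by_cases hk : k = d
  · subst hk
    rw [if_pos le_rfl, if_pos rfl, Nat.sub_self, Polynomial.coeff_zero_eq_eval_zero, hτ,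
      eval_zero_lineRestrict]
  · rw [if_neg (by omega), if_neg hk]

/-- These are the only test functions to which the two hypotheses are applied. -/
theorem represents_eval {v : Fin N → MvPolynomial (Fin N) 𝕜} (hsymm : ∀ r, (v r).IsSymmetric)
    (k : Fin N) :
    Represents v (fun x => MvPolynomial.eval x (v k)) (fun y => y k) where
  contDiff := contDiff_eval _
  symm σ x := by
    have := congrArg (MvPolynomial.eval x) (hsymm k σ)
    rwa [MvPolynomial.eval_rename] at this
  eq_comp x := rfl

theorem partialAt_apply (k r : Fin N) (y : Fin N → 𝕜) :
    partialAt (fun y : Fin N → 𝕜 => y k) r y = if k = r then 1 else 0 := by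
  rw [partialAt, (hasFDerivAt_apply k y).fderiv]
  simp [Pi.single_apply]

theorem LeadingCoeffOne.exists_sum_eq {v : Fin N → MvPolynomial (Fin N) 𝕜}
    (hsymm : ∀ r, (v r).IsSymmetric) {r : Fin N} (h : LeadingCoeffOne v r) :
    ∃ q : (Fin N → 𝕜) → Fin N → 𝕜, ∀ x : Fin N → 𝕜, Function.Injective x →
      q x r = 1 ∧ ∀ k, ∑ d : Fin N, q x d * pointD x (d + 1) (v k) = if k = r then 1 else 0 := by
  obtain ⟨q, hq1, hq⟩ := h
  refine ⟨fun x d => q d x, fun x hx => ⟨hq1 x hx, fun k => ?_⟩⟩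
  have := hq _ _ (represents_eval hsymm k) x hx (by fun_prop)
  rw [partialAt_apply] at this
  rw [this]
  simp [D_eval]

open Asymptotics Bornology in
/-- Away from the zeros of a nonzero polynomial, the coefficients of the `∂_i` in `∂η/∂v_r` stay
bounded along every line. -/
theorem NoNumerators.exists_bounded {v : Fin N → MvPolynomial (Fin N) 𝕜}
    (hsymm : ∀ r, (v r).IsSymmetric) {r : Fin N} (h : NoNumerators v r) :
    ∃ (G : MvPolynomial (Fin N) 𝕜) (c : (Fin N → 𝕜) → Fin N → 𝕜), G ≠ 0 ∧
      (∀ x, MvPolynomial.eval x G ≠ 0 → Function.Injective x ∧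
        ∀ k, ∑ i, c x i * MvPolynomial.eval x (MvPolynomial.pderiv i (v k)) =
          if k = r then 1 else 0) ∧
      ∀ x w : Fin N → 𝕜, ∀ i,
        (fun t => c (fun j => x j + t * w j) i) =O[cobounded 𝕜] (fun _ => (1 : 𝕜)) := by
  obtain ⟨m, a, ind, p, hp, hφ⟩ := h
  refine ⟨distinctPoly 𝕜 (Fin N) * ∏ k, p k,
    fun x i => ∑ k, if ind k = i then a k * (MvPolynomial.eval x (p k))⁻¹ else 0,
    mul_ne_zero distinctPoly_ne_zero (prod_ne_zero_iff.2 fun k _ => hp k), ?_, ?_⟩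
  · intro x hx
    rw [map_mul, map_prod] at hx
    have hinj := eval_distinctPoly_ne_zero.1 (left_ne_zero_of_mul hx)
    refine ⟨hinj, fun k => ?_⟩
    have := hφ _ _ (represents_eval hsymm k) x hinj
      (fun j => prod_ne_zero_iff.1 (right_ne_zero_of_mul hx) j (mem_univ _)) (by fun_prop)
    rw [partialAt_apply] at this
    rw [this]
    simp only [sum_mul, ite_mul, zero_mul]
    rw [sum_comm]
    refine sum_congr rfl fun j _ => ?_
    rw [sum_ite_eq, if_pos (mem_univ _), partialAt_eval]
    ring
  · intro x w i
    have h1 : ∀ k ∈ univ, (fun t : 𝕜 => if ind k = i then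
        a k * (MvPolynomial.eval (fun j => x j + t * w j) (p k))⁻¹ else 0)
        =O[cobounded 𝕜] (fun _ => (1 : 𝕜)) := by
      intro k _
      by_cases hk : ind k = i
      · simp only [hk, if_true, ← eval_lineRestrict]
        exact (inv_eval_isBigO_one (lineRestrict x w (p k))).const_mul_left _
      · simp only [hk, if_false]
        exact isBigO_zero (fun _ : 𝕜 => (1 : 𝕜)) _
    exact IsBigO.fun_sum h1

end

/-! ### The matrix of the `D_d v_k` and its inverse -/

section

variable {𝕜 : Type*} [RCLike 𝕜] {N : ℕ}

/-- The matrix of the coefficients of the `∂_i` in `D_1, …, D_N`. -/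
noncomputable def weightMatrix (x : Fin N → 𝕜) : Matrix (Fin N) (Fin N) 𝕜 :=
  Matrix.of fun d i => weight x (d + 1) i

/-- The Jacobian matrix of `v`. -/
noncomputable def jacobian (v : Fin N → MvPolynomial (Fin N) 𝕜) (x : Fin N → 𝕜) :
    Matrix (Fin N) (Fin N) 𝕜 :=
  Matrix.of fun k i => MvPolynomial.eval x (MvPolynomial.pderiv i (v k))

/-- The matrix of the values `D_d v_k`. -/
noncomputable def pointDMatrix (v : Fin N → MvPolynomial (Fin N) 𝕜) (x : Fin N → 𝕜) :
    Matrix (Fin N) (Fin N) 𝕜 :=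
  Matrix.of fun d k => pointD x (d + 1) (v k)

theorem pointDMatrix_eq_mul (v : Fin N → MvPolynomial (Fin N) 𝕜) (x : Fin N → 𝕜) :
    pointDMatrix v x = weightMatrix x * (jacobian v x).transpose := by
  ext d k
  simp [pointDMatrix, weightMatrix, jacobian, Matrix.mul_apply, pointD]

theorem weightMatrix_add (x : Fin N → 𝕜) (t : 𝕜) :
    weightMatrix (fun j => x j + t) = weightMatrix x := by
  ext d i
  simp [weightMatrix, weight_add_const]

/-- The entry has degree `k - d ≤ 0`, so as a polynomial it is constant, and zero below the
diagonal. -/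
theorem eval_eq_of_pointDMatrix {v : Fin N → MvPolynomial (Fin N) 𝕜}
    (hhom : ∀ r : Fin N, (v r).IsHomogeneous ((r : ℕ) + 1)) {d k : Fin N} (hkd : k ≤ d)
    {g : MvPolynomial (Fin N) 𝕜}
    (hg : ∀ x, Function.Injective x → pointDMatrix v x d k = MvPolynomial.eval x g)
    {x : Fin N → 𝕜} (hx : Function.Injective x) :
    pointDMatrix v x d k = if k = d then MvPolynomial.eval 0 g else 0 := by
  rw [hg x hx, eval_eq_of_scaling (d := d) (k := k) _ hkd]
  · simp only [Fin.ext_iff]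
  · intro t ht
    have htx : Function.Injective fun j => t * x j := (mul_right_injective₀ ht).comp hx
    rw [← hg x hx, ← hg _ htx]
    exact pointD_smul_of_isHomogeneous (hhom k) x ht d

/-- The inverse of the matrix of the `D_d v_k` has symmetric polynomial entries. -/
theorem exists_symmetric_inverse {v : Fin N → MvPolynomial (Fin N) 𝕜}
    (hsymm : ∀ r : Fin N, (v r).IsSymmetric)
    (hhom : ∀ r : Fin N, (v r).IsHomogeneous ((r : ℕ) + 1))
    {Q : (Fin N → 𝕜) → Matrix (Fin N) (Fin N) 𝕜}
    (hQ : ∀ x, Function.Injective x → Q x * pointDMatrix v x = 1) :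
    ∃ P : Matrix (Fin N) (Fin N) (MvPolynomial.symmetricSubalgebra (Fin N) 𝕜),
      ∀ x, Function.Injective x → ∀ r d, Q x r d = MvPolynomial.eval x (P r d).1 := by
  have h : ∀ d k : Fin N, ∃ g : MvPolynomial.symmetricSubalgebra (Fin N) 𝕜,
      ∀ x, Function.Injective x → pointDMatrix v x d k = MvPolynomial.eval x g.1 := fun d k =>
    exists_symmetric_pointD (hsymm k) (Nat.succ_ne_zero d) d.2
  choose T hT using h
  set ev : (Fin N → 𝕜) → MvPolynomial.symmetricSubalgebra (Fin N) 𝕜 →+* 𝕜 := fun x =>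
    (MvPolynomial.eval x).comp (MvPolynomial.symmetricSubalgebra (Fin N) 𝕜).val.toRingHom with hev
  have hmap : ∀ x, Function.Injective x → (ev x).mapMatrix (Matrix.of T) = pointDMatrix v x := by
    intro x hx
    ext d k
    rw [hT d k x hx]
    rfl
  set c : 𝕜 := ∏ d, MvPolynomial.eval 0 (T d d).1 with hc
  have hdet : ∀ x, Function.Injective x → (pointDMatrix v x).det = c := by
    intro x hx
    rw [Matrix.det_of_isUpperTriangular, hc]
    · refine prod_congr rfl fun d _ => ?_
      rw [eval_eq_of_pointDMatrix hhom le_rfl (hT d d) hx, if_pos rfl]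
    · intro d k hkd
      have hkd : k < d := hkd
      rw [eval_eq_of_pointDMatrix hhom (le_of_lt hkd) (hT d k) hx, if_neg (ne_of_lt hkd)]
  -- Since the determinant is a constant, the adjugate formula gives the inverse with no polynomial
  -- denominators.
  refine ⟨Matrix.of fun r d => algebraMap 𝕜 _ c⁻¹ * (Matrix.of T).adjugate r d, fun x hx r d => ?_⟩
  have hc0 : c ≠ 0 := by
    rw [← hdet x hx]
    intro h0
    have := congrArg Matrix.det (hQ x hx)
    rw [Matrix.det_mul, h0, mul_zero, Matrix.det_one] at this
    exact zero_ne_one this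
  have h1 : Q x = c⁻¹ • (pointDMatrix v x).adjugate := by
    have h2 : Q x * (pointDMatrix v x * (pointDMatrix v x).adjugate) =
        (pointDMatrix v x).adjugate := by
      rw [← Matrix.mul_assoc, hQ x hx, Matrix.one_mul]
    rw [Matrix.mul_adjugate, hdet x hx, Matrix.mul_smul, Matrix.mul_one] at h2
    rw [← h2, smul_smul, inv_mul_cancel₀ hc0, one_smul]
  have h3 : (ev x).mapMatrix (Matrix.of T).adjugate = (pointDMatrix v x).adjugate := by
    rw [RingHom.map_adjugate, hmap x hx]
  rw [h1, ← h3]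
  simp [hev, MvPolynomial.algebraMap_eq]

section Constant

open Asymptotics Bornology

variable {v : Fin N → MvPolynomial (Fin N) 𝕜} {Q : (Fin N → 𝕜) → Matrix (Fin N) (Fin N) 𝕜}

theorem weightMatrix_mul_eq_one (hQ : ∀ x, Function.Injective x → Q x * pointDMatrix v x = 1)
    {x : Fin N → 𝕜} (hx : Function.Injective x) :
    weightMatrix x * ((jacobian v x).transpose * Q x) = 1 := by
  have := hQ x hx
  rw [pointDMatrix_eq_mul, mul_eq_one_comm] at this
  rw [← Matrix.mul_assoc, this]

/-- The coefficients of the `∂_i` in `∂η/∂v_r`, computed from those of the `D_d`. -/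
theorem eq_sum_mul_weight (hQ : ∀ x, Function.Injective x → Q x * pointDMatrix v x = 1)
    {x : Fin N → 𝕜} (hx : Function.Injective x) {r : Fin N} {c : Fin N → 𝕜}
    (hc : ∀ k, ∑ i, c i * MvPolynomial.eval x (MvPolynomial.pderiv i (v k)) =
      if k = r then 1 else 0) :
    c = Matrix.vecMul (Q x r) (weightMatrix x) := by
  have h1 : Matrix.vecMul c (jacobian v x).transpose = Pi.single r 1 := by
    ext k
    rw [Pi.single_apply, ← hc k]
    rfl
  have h2 : (jacobian v x).transpose * (Q x * weightMatrix x) = 1 := by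
    rw [← Matrix.mul_assoc, mul_eq_one_comm]
    exact weightMatrix_mul_eq_one hQ hx
  have h3 := congrArg (fun y => Matrix.vecMul y (Q x * weightMatrix x)) h1
  simp only [Matrix.vecMul_vecMul, h2, Matrix.vecMul_one, Matrix.single_one_vecMul] at h3
  rw [h3]
  ext i
  rfl

variable {P : Matrix (Fin N) (Fin N) (MvPolynomial.symmetricSubalgebra (Fin N) 𝕜)}

theorem eventually_eval_line_ne_zero {G : MvPolynomial (Fin N) 𝕜} {x : Fin N → 𝕜}
    (hx : MvPolynomial.eval x G ≠ 0) (w : Fin N → 𝕜) :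
    ∀ᶠ t in cobounded 𝕜, MvPolynomial.eval (fun j => x j + t * w j) G ≠ 0 := by
  have : lineRestrict x w G ≠ 0 := fun h => hx (by
    rw [← eval_zero_lineRestrict x w, h, Polynomial.eval_zero])
  simpa only [eval_lineRestrict] using eventually_eval_ne_zero this

/-- The weights depend only on differences of coordinates. On the line `x + t (1, …, 1)`, row `r` of
`Q` is thus the bounded vector `c` times a fixed matrix, and a bounded polynomial in `t` is
constant. -/
theorem sum_pderiv_eq_zero (hQ : ∀ x, Function.Injective x → Q x * pointDMatrix v x = 1)
    (hP : ∀ x, Function.Injective x → ∀ r d, Q x r d = MvPolynomial.eval x (P r d).1)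
    (hsymm : ∀ r, (v r).IsSymmetric) {r : Fin N} (hnum : NoNumerators v r) (d : Fin N) :
    ∑ i, MvPolynomial.pderiv i (P r d).1 = 0 := by
  obtain ⟨G, c, hG, hc, hbdd⟩ := hnum.exists_bounded hsymm
  refine eq_zero_of_eval_eq_zero hG fun x hx => ?_
  have hinj := (hc x hx).1
  have h1 : (fun t => (lineRestrict x (fun _ => 1) (P r d).1).eval t) =O[cobounded 𝕜]
      (fun _ => (1 : 𝕜)) := by
    have h2 : (fun t => ∑ i, c (fun j => x j + t * 1) i *
        ((jacobian v x).transpose * Q x) i d) =O[cobounded 𝕜] (fun _ => (1 : 𝕜)) :=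
      IsBigO.fun_sum fun i _ => by
        simpa only [mul_comm] using (hbdd x (fun _ => 1) i).const_mul_left
          (((jacobian v x).transpose * Q x) i d)
    refine h2.congr' ?_ Filter.EventuallyEq.rfl
    filter_upwards [eventually_eval_line_ne_zero hx fun _ => 1] with t ht
    obtain ⟨hinj', hc'⟩ := hc _ ht
    have h3 := eq_sum_mul_weight hQ hinj' hc'
    simp only [mul_one] at h3 hinj' ⊢
    rw [weightMatrix_add] at h3
    -- The multiplier is the inverse of the weight matrix, taken at the base point `x`.
    have h4 := congrArg (fun y => Matrix.vecMul y ((jacobian v x).transpose * Q x) d) h3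
    simp only [Matrix.vecMul_vecMul, weightMatrix_mul_eq_one hQ hinj, Matrix.vecMul_one] at h4
    rw [eval_lineRestrict]
    simp only [mul_one]
    rw [← hP _ hinj', ← h4]
    rfl
  have h5 := derivative_lineRestrict x (fun _ => 1) (P r d).1
  rw [eq_C_of_eval_isBigO_one h1, Polynomial.derivative_C] at h5
  have h6 := congrArg (Polynomial.eval 0) h5
  simpa [Polynomial.eval_finsetSum, eval_zero_lineRestrict] using h6.symm

/-- The polynomial `∂(eNorm (h + 1))/∂v_r`. -/
noncomputable def eNormDeriv
    (P : Matrix (Fin N) (Fin N) (MvPolynomial.symmetricSubalgebra (Fin N) 𝕜)) (r h : Fin N) :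
    MvPolynomial (Fin N) 𝕜 :=
  ∑ d : Fin N, (P r d).1 * if d ≤ h then eNorm 𝕜 N (h - d) else 0

theorem eval_eNormDeriv
    (hP : ∀ x, Function.Injective x → ∀ r d, Q x r d = MvPolynomial.eval x (P r d).1)
    {x : Fin N → 𝕜} (hx : Function.Injective x) (r h : Fin N) :
    MvPolynomial.eval x (eNormDeriv P r h) =
      ∑ i, Matrix.vecMul (Q x r) (weightMatrix x) i *
        MvPolynomial.eval x (MvPolynomial.pderiv i (eNorm 𝕜 N (h + 1))) := by
  have h1 : ∀ d : Fin N, MvPolynomial.eval x (if d ≤ h then eNorm 𝕜 N (h - d) else 0) =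
      pointD x (d + 1) (eNorm 𝕜 N (h + 1)) := by
    intro d
    rw [pointD_eNorm hx (Nat.succ_ne_zero d) d.2 h.2, Nat.succ_sub_succ]
    by_cases hd : d ≤ h
    · rw [if_pos hd, if_pos (Nat.succ_le_succ hd)]
    · rw [if_neg hd, if_neg (fun h' => hd (Nat.le_of_succ_le_succ h')), map_zero]
  simp only [eNormDeriv, map_sum, map_mul, h1, ← hP x hx, pointD, Matrix.vecMul, dotProduct,
    weightMatrix, Matrix.of_apply, sum_mul, mul_sum]
  rw [sum_comm]
  exact sum_congr rfl fun i _ => sum_congr rfl fun d _ => by ring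

/-- By the chain rule this is a sum of coefficients bounded in the direction `x_j` times derivatives
of `eNorm (h + 1)`, which are affine in `x_j`; a polynomial of at most linear growth is affine. -/
theorem pderiv_pderiv_eNormDeriv
    (hQ : ∀ x, Function.Injective x → Q x * pointDMatrix v x = 1)
    (hP : ∀ x, Function.Injective x → ∀ r d, Q x r d = MvPolynomial.eval x (P r d).1)
    (hsymm : ∀ r, (v r).IsSymmetric) {r : Fin N} (hnum : NoNumerators v r) (h j : Fin N) :
    MvPolynomial.pderiv j (MvPolynomial.pderiv j (eNormDeriv P r h)) = 0 := by
  obtain ⟨G, c, hG, hc, hbdd⟩ := hnum.exists_bounded hsymm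
  refine eq_zero_of_eval_eq_zero hG fun x hx => ?_
  rw [← eval_zero_lineRestrict x (Pi.single j 1), ← derivative_lineRestrict_single,
    ← derivative_lineRestrict_single, derivative_derivative_eq_zero_of_isBigO,
    Polynomial.eval_zero]
  have h2 : (fun t => ∑ i, c (fun k => x k + t * (Pi.single j 1 : Fin N → 𝕜) k) i *
      (lineRestrict x (Pi.single j 1) (MvPolynomial.pderiv i (eNorm 𝕜 N (h + 1)))).eval t)
      =O[cobounded 𝕜] (fun t => t) := by
    refine IsBigO.fun_sum fun i _ => ?_
    have h3 : Polynomial.derivative (Polynomial.derivative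
        (lineRestrict x (Pi.single j 1) (MvPolynomial.pderiv i (eNorm 𝕜 N (h + 1))))) = 0 := by
      rw [derivative_lineRestrict_single, derivative_lineRestrict_single, pderiv_pderiv_comm j i,
        pderiv_pderiv_comm j i, pderiv_pderiv_eNorm j h.2, map_zero, map_zero]
    simpa only [one_mul] using (hbdd x (Pi.single j 1) i).mul (eval_isBigO_id h3)
  refine h2.congr' ?_ Filter.EventuallyEq.rfl
  filter_upwards [eventually_eval_line_ne_zero hx (Pi.single j 1)] with t ht
  obtain ⟨hinj', hc'⟩ := hc _ ht
  rw [eq_sum_mul_weight hQ hinj' hc', eval_lineRestrict, eval_eNormDeriv hP hinj']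
  simp only [eval_lineRestrict]

theorem exists_eq_C (hQ : ∀ x, Function.Injective x → Q x * pointDMatrix v x = 1)
    (hP : ∀ x, Function.Injective x → ∀ r d, Q x r d = MvPolynomial.eval x (P r d).1)
    (hsymm : ∀ r, (v r).IsSymmetric) {r : Fin N} (hnum : NoNumerators v r) (h : Fin N) :
    ∃ c, (P r h).1 = MvPolynomial.C c := by
  induction h using WellFoundedLT.induction with
  | ind h ih =>
  refine ⟨_, eq_C_of_symmetric_of_affine_of_translation (P r h).2 (fun j => ?_)
    (sum_pderiv_eq_zero hQ hP hsymm hnum h)⟩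
  have h1 := pderiv_pderiv_eNormDeriv hQ hP hsymm hnum h j
  -- The term `d = h` is `P r h` itself, as `eNorm 0 = 1`; those with `d < h` have constant
  -- coefficients by induction and are already affine in `x_j`.
  rw [eNormDeriv, map_sum, map_sum, sum_eq_single h] at h1
  · simpa [eNorm_zero] using h1
  · intro d _ hd
    split_ifs with hdh
    · obtain ⟨c, hc⟩ := ih d (lt_of_le_of_ne hdh hd)
      rw [hc, MvPolynomial.pderiv_C_mul, MvPolynomial.pderiv_C_mul,
        pderiv_pderiv_eNorm j ((Nat.sub_le _ _).trans h.2.le), mul_zero]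
    · simp
  · simp

end Constant

theorem eval_zero_u {r : ℕ} (hr : r ≠ 0) : MvPolynomial.eval 0 (u 𝕜 N r) = 0 := by
  rw [u, map_sum]
  refine sum_eq_zero fun p _ => ?_
  rw [map_mul, map_multiset_prod, Multiset.map_map]
  refine mul_eq_zero_of_right _ (Multiset.prod_eq_zero ?_)
  have hne : p.parts ≠ 0 := fun h => hr (by rw [← p.parts_sum, h]; simp)
  obtain ⟨h, hh⟩ := Multiset.exists_mem_of_ne_zero hne
  refine Multiset.mem_map.2 ⟨h, hh, ?_⟩
  rw [Function.comp_apply, eval_eNorm, MvPolynomial.esymm]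
  refine mul_eq_zero_of_right _ ?_
  rw [map_sum]
  refine sum_eq_zero fun S hS => ?_
  have : S.Nonempty := card_pos.1 (by
    rw [(mem_powersetCard.1 hS).2]; exact p.parts_pos hh)
  obtain ⟨i, hi⟩ := this
  rw [map_prod]
  exact prod_eq_zero hi (by simp)

theorem pointD_eq_of_constant {v : Fin N → MvPolynomial (Fin N) 𝕜}
    (hhom : ∀ r : Fin N, (v r).IsHomogeneous ((r : ℕ) + 1))
    {Q : (Fin N → 𝕜) → Matrix (Fin N) (Fin N) 𝕜}
    (hQ : ∀ x, Function.Injective x → Q x * pointDMatrix v x = 1)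
    (hdiag : ∀ x, Function.Injective x → ∀ r, Q x r r = 1)
    (hconst : ∃ M, ∀ x, Function.Injective x → Q x = M)
    {x : Fin N → 𝕜} (hx : Function.Injective x) : pointDMatrix v x = 1 := by
  obtain ⟨M, hM⟩ := hconst
  -- Compare `x` with `2 x`: a constant entry that scales by `2 ^ (k - d)` is zero unless `k = d`.
  have hy : Function.Injective fun j => (2 : 𝕜) * x j := (mul_right_injective₀ two_ne_zero).comp hx
  have h1 : pointDMatrix v (fun j => 2 * x j) = pointDMatrix v x := by
    have hx' := hQ x hx
    have hy' := hQ _ hy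
    rw [hM x hx] at hx'
    rw [hM _ hy] at hy'
    rw [← Matrix.one_mul (pointDMatrix v fun j => 2 * x j), ← mul_eq_one_comm.1 hx',
      Matrix.mul_assoc, hy', Matrix.mul_one]
  have h2 : ∀ d k : Fin N, d ≠ k → pointDMatrix v x d k = 0 := by
    intro d k hdk
    have h3 : (2 : 𝕜) ^ (d : ℕ) * pointDMatrix v (fun j => 2 * x j) d k =
        (2 : 𝕜) ^ (k : ℕ) * pointDMatrix v x d k :=
      pointD_smul_of_isHomogeneous (hhom k) x two_ne_zero d
    rw [h1] at h3
    by_contra h0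
    have h4 : (2 : 𝕜) ^ (d : ℕ) = (2 : 𝕜) ^ (k : ℕ) := mul_right_cancel₀ h0 h3
    have h5 : (2 : ℕ) ^ (d : ℕ) = 2 ^ (k : ℕ) := by exact_mod_cast h4
    exact hdk (Fin.ext (Nat.pow_right_injective le_rfl h5))
  ext d k
  by_cases hdk : d = k
  · subst hdk
    have h6 := congrFun (congrFun (hQ x hx) d) d
    rw [Matrix.mul_apply, sum_eq_single d (fun b _ hb => by rw [h2 b d hb, mul_zero]) (by simp),
      hdiag x hx, one_mul] at h6
    exact h6
  · rw [h2 d k hdk, Matrix.one_apply_ne hdk]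

end

end SymCoord

/-! ### Comparison of `v` with `u` -/

theorem theorem2p1 {𝕜 : Type*} [RCLike 𝕜] (N : ℕ)
    (v : Fin N → MvPolynomial (Fin N) 𝕜)
    (hsymm : ∀ r : Fin N, (v r).IsSymmetric)
    (hhom : ∀ r : Fin N, (v r).IsHomogeneous ((r : ℕ) + 1))
    (hcoord : AlgebraicIndependent 𝕜 v)
    (hnum : ∀ r : Fin N, SymCoord.NoNumerators v r)
    (hone : ∀ r : Fin N, SymCoord.LeadingCoeffOne v r) :
    ∀ r : Fin N, v r = SymCoord.u 𝕜 N ((r : ℕ) + 1) := by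
  open SymCoord in
  choose q hq using fun r => (hone r).exists_sum_eq hsymm
  set Q : (Fin N → 𝕜) → Matrix (Fin N) (Fin N) 𝕜 := fun x => Matrix.of fun r d => q r x d with hQd
  have hQ : ∀ x, Function.Injective x → Q x * pointDMatrix v x = 1 := by
    intro x hx
    ext r k
    rw [Matrix.mul_apply, Matrix.one_apply]
    exact ((hq r x hx).2 k).trans (if_congr eq_comm rfl rfl)
  obtain ⟨P, hP⟩ := exists_symmetric_inverse hsymm hhom hQ
  choose M hM using fun r h => exists_eq_C hQ hP hsymm (hnum r) h
  have hT : ∀ x : Fin N → 𝕜, Function.Injective x → pointDMatrix v x = 1 := fun x hx =>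
    pointD_eq_of_constant hhom hQ (fun x hx r => (hq r x hx).1)
      ⟨Matrix.of M, fun x hx => by
        ext r d
        rw [hP x hx, hM, MvPolynomial.eval_C, Matrix.of_apply]⟩ hx
  have hU : ∀ x : Fin N → 𝕜, Function.Injective x →
      pointDMatrix (fun k : Fin N => u 𝕜 N (k + 1)) x = 1 := by
    intro x hx
    ext d k
    rw [pointDMatrix, Matrix.of_apply, pointD_u hx (Nat.succ_ne_zero d) d.2
      (Nat.succ_ne_zero k) k.2, Matrix.one_apply]
    exact if_congr (by simp [Fin.ext_iff, eq_comm]) rfl rfl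
  intro r
  have h1 : ∀ i, MvPolynomial.pderiv i (v r - u 𝕜 N (r + 1)) = 0 := by
    intro i
    refine eq_zero_of_eval_eq_zero (distinctPoly_ne_zero (K := 𝕜)) fun x hx => ?_
    have hx := eval_distinctPoly_ne_zero.1 hx
    have h2 := hT x hx
    have h3 := hU x hx
    rw [pointDMatrix_eq_mul, mul_eq_one_comm] at h2 h3
    -- Both transposed Jacobians are right inverses of the same square weight matrix.
    have h4 : (jacobian v x).transpose =
        (jacobian (fun k : Fin N => u 𝕜 N (k + 1)) x).transpose := by
      rw [← Matrix.one_mul (jacobian v x).transpose, ← h3, Matrix.mul_assoc,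
        mul_eq_one_comm.1 h2, Matrix.mul_one]
    have h5 := congrFun (congrFun h4 i) r
    rw [map_sub, map_sub, sub_eq_zero]
    exact h5
  have h2 := eq_C_of_pderiv_eq_zero h1
  have h3 := congrArg (MvPolynomial.eval 0) h2
  have h4 : MvPolynomial.eval 0 (v r) = 0 := by
    have := eval_mul_of_isHomogeneous (hhom r) 0 0
    simpa using this
  rw [map_sub, h4, eval_zero_u (Nat.succ_ne_zero r), sub_zero, MvPolynomial.eval_C] at h3
  rw [← h3, map_zero] at h2
  exact sub_eq_zero.1 h2
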